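/- Let $q$ be a complex number with $0<|q|<1$. Write $(a)_\infty=(a;q)_\infty=\prod_{k\ge 0}(1-aq^k)$ and $\Theta(x;q)=(x)_\infty(q/x)_\infty(q)_\infty$. For integers $r,s$ put $\mathrm{sg}(r)=1$ if $r\ge 0$, $\mathrm{sg}(r)=-1$ if $r<0$, $\mathrm{sg}(r,s)=\frac{\mathrm{sg}(r)+\mathrm{sg}(s)}{2}$ and $\binom{r}{2}=\frac{r(r-1)}{2}$. For positive integers $a,b,c$ let $$f_{a,b,c}(x,y;q)=\sum_{r,s\in\mathbb Z}\mathrm{sg}(r,s)(-1)^{r+s}x^ry^sq^{a\binom r2+brs+c\binom s2}.$$ Let $t,m\in\mathbb Z$ with $t\ge 1$, $-t\le m\le 3t-2$ and $t\equiv m\pmod 2$, and let $x$ be a nonzero complex number that is not an integral power of $q$. Define $$g_{t,m}(x;q)=\Big(\sum_{r,s\ge 0}-\sum_{r,s<0}\Big)\frac{(-1)^{r+s}q^{\frac{r^2}{2}+2trs+\frac{s^2}{2}+\frac{t+1+m}{2}r+\frac{t+1-m}{2}s}}{1-xq^r},\qquad \mathcal U_t^{(m)}(x;q)=\frac{1-x}{(q)_\infty^2}\,g_{t,m}(x;q).$$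 Then all the double series below and in the definition of $g_{t,m}(x;q)$ converge absolutely, and $$\begin{aligned}\mathcal U_t^{(m)}(x;q)=\frac{1-x}{\Theta(x;q)}\,\frac{q^{1-3t^2-\frac{t-m}{2}+tm}}{(q)_\infty^2}\sum_{k=0}^{4t^2-2}(-1)^{k+1}q^{\binom{k+1}{2}+k}\,&f_{1,2t,1}\big(q^{2-4t^2+\frac{t+m}{2}+k},\,q^{1+\frac{t-m}{2}};q\big)\\ \times\ &f_{1,4t^2-1,4t^2(4t^2-1)}\big(x^{-1}q^{k+1},\,-q^{4t^2k-t^2+tm-\frac{t-m}{2}+8t^4};q\big).\end{aligned}$$ -/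

import Mathlib

noncomputable section

namespace HeckeAppell

/-- The infinite `q`-Pochhammer symbol `(a;q)_∞ = ∏_{k ≥ 0} (1 - a q^k)`. -/
def qPochInf (a q : ℂ) : ℂ := ∏' k : ℕ, (1 - a * q ^ k)

/-- The infinite product converges for `|q| < 1`. -/
theorem multipliable_qPochInf (a : ℂ) {q : ℂ} (hq : ‖q‖ < 1) :
    Multipliable fun k : ℕ => 1 - a * q ^ k := by
  have h : Summable fun k : ℕ => ‖-(a * q ^ k)‖ := by
    simpa [norm_mul, norm_pow] using
      (summable_geometric_of_lt_one (norm_nonneg q) hq).mul_left ‖a‖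
  simpa [sub_eq_add_neg] using multipliable_one_add_of_summable h

/-- `Θ(x;q) = (x;q)_∞ (q/x;q)_∞ (q;q)_∞`. -/
def Theta (x q : ℂ) : ℂ := qPochInf x q * qPochInf (q / x) q * qPochInf q q

/-- `sg(r) = 1` for `r ≥ 0` and `-1` for `r < 0`. -/
def sg (r : ℤ) : ℂ := if 0 ≤ r then 1 else -1

/-- `sg(r,s) = (sg(r) + sg(s)) / 2`. -/
def sg₂ (r s : ℤ) : ℂ := (sg r + sg s) / 2

/-- The binomial coefficient `n(n-1)/2` for every integer `n`. -/
def binomTwo (n : ℤ) : ℤ := n * (n - 1) / 2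

/-- The integer division in `binomTwo` is exact. -/
theorem two_mul_binomTwo (n : ℤ) : 2 * binomTwo n = n * (n - 1) :=
  Int.mul_ediv_cancel' (Int.even_mul_pred_self n).two_dvd

/-- The `(r,s)` term of the Hecke-type double sum `f_{a,b,c}(x,y;q)`. -/
def heckeTerm (a b c : ℤ) (x y q : ℂ) (p : ℤ × ℤ) : ℂ :=
  sg₂ p.1 p.2 * (-1) ^ (p.1 + p.2) * x ^ p.1 * y ^ p.2 *
    q ^ (a * binomTwo p.1 + b * p.1 * p.2 + c * binomTwo p.2)

/-- The Hecke-type double sum `f_{a,b,c}(x,y;q)`, over all `(r,s) ∈ ℤ²`. -/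
def heckeF (a b c : ℤ) (x y q : ℂ) : ℂ := ∑' p : ℤ × ℤ, heckeTerm a b c x y q p

/-- The exponent `r²/2 + 2trs + s²/2 + (t+1+m)r/2 + (t+1-m)s/2`, an integer when
`t ≡ m (mod 2)`. -/
def gExponent (t m r s : ℤ) : ℤ :=
  (r ^ 2 + 4 * t * r * s + s ^ 2 + (t + 1 + m) * r + (t + 1 - m) * s) / 2

/-- For `t ≡ m (mod 2)` the integer division in `gExponent` is exact. -/
theorem two_mul_gExponent {t m : ℤ} (h : t ≡ m [ZMOD 2]) (r s : ℤ) :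
    2 * gExponent t m r s =
      r ^ 2 + 4 * t * r * s + s ^ 2 + (t + 1 + m) * r + (t + 1 - m) * s := by
  refine Int.mul_ediv_cancel' ?_
  obtain ⟨u, hu⟩ := h.dvd
  obtain ⟨v, hv⟩ := (Int.even_mul_succ_self r).two_dvd
  obtain ⟨w, hw⟩ := (Int.even_mul_succ_self s).two_dvd
  obtain rfl : m = t + 2 * u := by linarith
  exact ⟨v + w + 2 * t * r * s + (t + u) * r - u * s, by linear_combination hv + hw⟩

/-- The summand of `g_{t,m}(x;q)`. -/
def gTerm (t m : ℤ) (x q : ℂ) (r s : ℤ) : ℂ :=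
  (-1) ^ (r + s) * q ^ gExponent t m r s / (1 - x * q ^ r)

/-- The summand of `g_{t,m}` on the quadrant `r, s ≥ 0`. -/
def gTermNonneg (t m : ℤ) (x q : ℂ) (p : ℕ × ℕ) : ℂ := gTerm t m x q p.1 p.2

/-- The summand of `g_{t,m}` on the quadrant `r, s < 0`, with `r = -1 - p.1`, `s = -1 - p.2`. -/
def gTermNeg (t m : ℤ) (x q : ℂ) (p : ℕ × ℕ) : ℂ := gTerm t m x q (-1 - p.1) (-1 - p.2)

/-- The Hecke–Appell series `g_{t,m}(x;q)`: the sum over `r, s ≥ 0` minus the sum over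
`r, s < 0`. -/
def gSeries (t m : ℤ) (x q : ℂ) : ℂ :=
  (∑' p : ℕ × ℕ, gTermNonneg t m x q p) - ∑' p : ℕ × ℕ, gTermNeg t m x q p

/-- `𝒰_t^{(m)}(x;q) = (1 - x) / (q)_∞² · g_{t,m}(x;q)`. -/
def calU (t m : ℤ) (x q : ℂ) : ℂ := (1 - x) / qPochInf q q ^ 2 * gSeries t m x q

end HeckeAppell

end

/-!
The idea is to expand `Θ(x;q) g_{t,m}(x;q)` into one absolutely convergent fourfold series and to
sum it in two orders.

For each integer `r` the quotient `Θ(x;q) / (1 - x q^r)` is itself a Hecke-type double sum: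
`f_{1,1,1}(q/x, q^(r+1); q)` (`heckeF_one_one_one`). Indeed a unit shift of either summation index
of `f_{a,b,c}` reproduces the function at moved arguments plus a bilateral theta series
(`heckeF_shift_left`). For `a = b = c = 1` both shifts lead to the same arguments; one theta series
is `Θ(x;q)` by the Jacobi triple product (`hasSum_thetaTerm`, obtained from Cauchy's finite form by
dominated convergence), and the other one is taken at an integral power of `q`, where it vanishes
(`tsum_thetaTerm_zpow`).

Inserting this into `g_{t,m}` gives a series over `((r, s), (a, i))` carrying the two weights
`sg(r,s)` and `sg(a,i)`. It converges absolutely because of the bounds on `m`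
(`le_two_mul_quadExponent`). Summing over `(r, s)` first yields `f_{1,2t,1}` at integral powers of
`q`, the first argument being proportional to `q^i`. There the theta series in the shift relations
vanish again, so that `f_{1,2t,1}` is quasi-periodic in `i` with period `4t² - 1`
(`heckeF_zpow_quasiperiodic`). Writing `i = k + (4t² - 1) s` with `0 ≤ k ≤ 4t² - 2`, the remaining
sum over `(a, s)` is, for each `k`, a double sum `f_{1,4t²-1,4t²(4t²-1)}` (`tsum_residue`).
-/

noncomputable section

namespace HeckeAppell

open Filter Topology

/-! ### Nonvanishing of the infinite products -/

theorem qPochInf_ne_zero {a q : ℂ} (hq : ‖q‖ < 1) (h : ∀ k : ℕ, a * q ^ k ≠ 1) :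
    qPochInf a q ≠ 0 := by
  have hs : Summable fun k : ℕ => ‖-(a * q ^ k)‖ := by
    simpa [norm_mul, norm_pow] using
      (summable_geometric_of_lt_one (norm_nonneg q) hq).mul_left ‖a‖
  have := tprod_one_add_ne_zero_of_summable (f := fun k : ℕ => -(a * q ^ k))
    (fun k hk => h k (by linear_combination -hk)) hs
  simpa [qPochInf, sub_eq_add_neg] using this

theorem mul_pow_self_ne_one {q : ℂ} (hq : ‖q‖ < 1) (k : ℕ) : q * q ^ k ≠ 1 := by
  intro h
  have h1 : ‖q * q ^ k‖ = 1 := by rw [h, norm_one]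
  rw [← pow_succ', norm_pow] at h1
  exact (pow_lt_one₀ (norm_nonneg q) hq k.succ_ne_zero).ne h1

theorem qPochInf_self_ne_zero {q : ℂ} (hq : ‖q‖ < 1) : qPochInf q q ≠ 0 :=
  qPochInf_ne_zero hq (mul_pow_self_ne_one hq)

theorem Theta_ne_zero {x q : ℂ} (hq0 : q ≠ 0) (hq : ‖q‖ < 1) (hx : ∀ n : ℤ, x ≠ q ^ n) :
    Theta x q ≠ 0 := by
  have hx1 : ∀ k : ℕ, x * q ^ k ≠ 1 := fun k h => hx (-k) (by
    rw [zpow_neg, zpow_natCast]; exact eq_inv_of_mul_eq_one_left h)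
  refine mul_ne_zero (mul_ne_zero (qPochInf_ne_zero hq hx1) (qPochInf_ne_zero hq fun k h => ?_))
    (qPochInf_self_ne_zero hq)
  have hx0 : x ≠ 0 := by rintro rfl; simp at h
  apply hx (k + 1)
  rw [zpow_add₀ hq0, zpow_natCast, zpow_one]
  field_simp at h
  rw [← h]; ring

/-! ### The finite form of the triple product -/

/-- The finite `q`-Pochhammer symbol `(a;q)_n`. -/
def qPoch (a q : ℂ) (n : ℕ) : ℂ := ∏ k ∈ Finset.range n, (1 - a * q ^ k)

theorem tendsto_qPoch (a : ℂ) {q : ℂ} (hq : ‖q‖ < 1) :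
    Tendsto (qPoch a q) atTop (𝓝 (qPochInf a q)) :=
  (multipliable_qPochInf a hq).hasProd.tendsto_prod_nat

/-- The reciprocal `1/(q;q)_n`, extended by `0` to negative `n`, so that its recurrence holds for
every integer. -/
def invQFac (q : ℂ) (n : ℤ) : ℂ := if n < 0 then 0 else (qPoch q q n.toNat)⁻¹

theorem invQFac_sub_one {q : ℂ} (hq : ‖q‖ < 1) (n : ℤ) :
    invQFac q (n - 1) = (1 - q ^ n) * invQFac q n := by
  rcases lt_trichotomy n 0 with h | rfl | h
  · simp [invQFac, h, show n - 1 < 0 by omega]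
  · simp [invQFac]
  · obtain ⟨k, rfl⟩ : ∃ k : ℕ, n = k + 1 := ⟨(n - 1).toNat, by omega⟩
    have h0 : 1 - q * q ^ k ≠ 0 := sub_ne_zero.2 (mul_pow_self_ne_one hq k).symm
    have h1 : qPoch q q (k + 1) = qPoch q q k * (1 - q * q ^ k) := Finset.prod_range_succ _ _
    have h2 : q ^ ((k : ℤ) + 1) = q * q ^ k := by
      rw [← pow_succ']; exact_mod_cast zpow_natCast q (k + 1)
    have h3 : ((k : ℤ) + 1).toNat = k + 1 := by omega
    simp only [invQFac, add_sub_cancel_right, h2, h3, h1, Int.toNat_natCast,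
      if_neg (show ¬ ((k : ℤ) < 0) by omega), if_neg (show ¬ ((k : ℤ) + 1 < 0) by omega)]
    field_simp

theorem tendsto_inv_qPoch {q : ℂ} (hq : ‖q‖ < 1) :
    Tendsto (fun n => (qPoch q q n)⁻¹) atTop (𝓝 (qPochInf q q)⁻¹) :=
  (tendsto_qPoch q hq).inv₀ (qPochInf_self_ne_zero hq)

theorem exists_norm_invQFac_le {q : ℂ} (hq : ‖q‖ < 1) :
    ∃ C : ℝ, 0 ≤ C ∧ ∀ n, ‖invQFac q n‖ ≤ C := by
  obtain ⟨C, hC⟩ := (Metric.isBounded_range_of_tendsto _ (tendsto_inv_qPoch hq)).exists_norm_le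
  have hC0 : 0 ≤ C := (norm_nonneg _).trans (hC _ ⟨0, rfl⟩)
  refine ⟨C, hC0, fun n => ?_⟩
  unfold invQFac
  split_ifs
  · simpa using hC0
  · exact hC _ ⟨_, rfl⟩

theorem tendsto_invQFac {q : ℂ} (hq : ‖q‖ < 1) :
    Tendsto (invQFac q) atTop (𝓝 (qPochInf q q)⁻¹) := by
  have h := (tendsto_inv_qPoch hq).comp
    (tendsto_atTop_atTop.2 fun b : ℕ => ⟨(b : ℤ), fun a (h : (b : ℤ) ≤ a) =>
      show b ≤ a.toNat by omega⟩)
  refine h.congr' ?_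
  filter_upwards [eventually_ge_atTop 0] with n hn
  simp [invQFac, not_lt.2 hn]

theorem binomTwo_add_one (n : ℤ) : binomTwo (n + 1) = binomTwo n + n := by
  have h1 := two_mul_binomTwo n
  have h2 := two_mul_binomTwo (n + 1)
  linarith

theorem binomTwo_add (a b : ℤ) : binomTwo (a + b) = binomTwo a + binomTwo b + a * b := by
  have h1 := two_mul_binomTwo a
  have h2 := two_mul_binomTwo b
  have h3 := two_mul_binomTwo (a + b)
  linarith

/-- The term `(-1)^j q^(j(j-1)/2) x^j` of the bilateral theta series. -/
def thetaTerm (x q : ℂ) (j : ℤ) : ℂ := (-1) ^ j * x ^ j * q ^ binomTwo j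

theorem thetaTerm_add_one {x q : ℂ} (hq0 : q ≠ 0) (hx0 : x ≠ 0) (j : ℤ) :
    thetaTerm x q (j + 1) = -(x * q ^ j) * thetaTerm x q j := by
  rw [thetaTerm, thetaTerm, binomTwo_add_one, zpow_add₀ hq0, zpow_add₀ hx0,
    zpow_add₀ (by norm_num : (-1 : ℂ) ≠ 0), zpow_one, zpow_one]
  ring

theorem thetaTerm_sub_one {x q : ℂ} (hq0 : q ≠ 0) (hx0 : x ≠ 0) (j : ℤ) :
    x * thetaTerm x q (j - 1) = -(q * q ^ (-j)) * thetaTerm x q j := by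
  have h := thetaTerm_add_one hq0 hx0 (j - 1)
  rw [sub_add_cancel] at h
  rw [h, zpow_sub₀ hq0, zpow_neg, zpow_one]
  have : q ^ j ≠ 0 := zpow_ne_zero _ hq0
  field_simp

/-- Cauchy's finite form of the Jacobi triple product. -/
theorem hasSum_finite_tripleProduct {x q : ℂ} (hq0 : q ≠ 0) (hq : ‖q‖ < 1) (hx0 : x ≠ 0) (n : ℕ) :
    HasSum (fun j : ℤ => qPoch q q (2 * n) * (invQFac q (n + j) * invQFac q (n - j)) *
      thetaTerm x q j) (qPoch x q n * qPoch (q / x) q n) := by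
  induction n with
  | zero =>
    have h : ∀ j : ℤ, j ≠ 0 → qPoch q q (2 * 0) *
        (invQFac q ((0 : ℕ) + j) * invQFac q ((0 : ℕ) - j)) * thetaTerm x q j = 0 := by
      intro j hj
      rcases lt_or_gt_of_ne hj with h | h <;> simp [invQFac, h]
    simpa [qPoch, invQFac, thetaTerm, binomTwo] using hasSum_single (0 : ℤ) h
  | succ n ih =>
    -- Multiply the sum for `n` by `(1 - x q^n) (1 - q^(n+1)/x)`, expanded into the three powers of
    -- `x`, and compare coefficients of `x^j`; the factors `invQFac` of index `n ± j`, `n ± j - 1`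
    -- are all expressed through those of index `n + 1 ± j`.
    have hA := ih.mul_left (1 + q ^ (2 * n + 1))
    have hB := ((Equiv.subRight (1 : ℤ)).hasSum_iff.2 ih).mul_left (-(x * q ^ n))
    have hC := ((Equiv.addRight (1 : ℤ)).hasSum_iff.2 ih).mul_left (-(q ^ (n + 1) / x))
    have key := (hA.add hB).add hC
    have e1 : qPoch x q (n + 1) = qPoch x q n * (1 - x * q ^ n) := Finset.prod_range_succ _ _
    have e2 : qPoch (q / x) q (n + 1) = qPoch (q / x) q n * (1 - q / x * q ^ n) :=
      Finset.prod_range_succ _ _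
    have e3 : qPoch q q (2 * (n + 1)) =
        qPoch q q (2 * n) * (1 - q * q ^ (2 * n)) * (1 - q * q ^ (2 * n + 1)) := by
      rw [show 2 * (n + 1) = 2 * n + 1 + 1 by ring]
      unfold qPoch
      rw [Finset.prod_range_succ, Finset.prod_range_succ]
    have hval : qPoch x q (n + 1) * qPoch (q / x) q (n + 1) =
        (1 + q ^ (2 * n + 1)) * (qPoch x q n * qPoch (q / x) q n) +
          -(x * q ^ n) * (qPoch x q n * qPoch (q / x) q n) +
          -(q ^ (n + 1) / x) * (qPoch x q n * qPoch (q / x) q n) := by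
      rw [e1, e2]
      field_simp
      ring
    rw [hval]
    refine (congrArg (HasSum · _) (funext fun j => ?_)).mpr key
    have r1 := invQFac_sub_one hq (n + 1 + j)
    have r2 := invQFac_sub_one hq (n + j)
    have r3 := invQFac_sub_one hq (n + 1 - j)
    have r4 := invQFac_sub_one hq (n - j)
    rw [show (n : ℤ) + 1 + j - 1 = n + j by ring] at r1
    rw [show (n : ℤ) + 1 - j - 1 = n - j by ring] at r3
    rw [r1] at r2
    rw [r3] at r4
    have t1 := thetaTerm_sub_one hq0 hx0 j
    have t2 := thetaTerm_add_one hq0 hx0 j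
    simp only [Function.comp_apply, Equiv.subRight_apply, Equiv.coe_addRight]
    rw [e3, show (n : ℤ) + (j - 1) = n + j - 1 by ring, show (n : ℤ) + (j + 1) = n + 1 + j by ring,
      show (n : ℤ) - (j - 1) = n + 1 - j by ring, show (n : ℤ) - (j + 1) = n - j - 1 by ring,
      r1, r2, r3, r4, t2]
    push_cast
    have z1 : q ^ ((n : ℤ) + 1 + j) = q * (q ^ n * q ^ j) := by
      rw [zpow_add₀ hq0, zpow_add₀ hq0, zpow_natCast]; simp; ring
    have z2 : q ^ ((n : ℤ) + j) = q ^ n * q ^ j := by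
      rw [zpow_add₀ hq0, zpow_natCast]
    have z3 : q ^ ((n : ℤ) + 1 - j) = q * (q ^ n * (q ^ j)⁻¹) := by
      rw [zpow_sub₀ hq0, zpow_add₀ hq0, zpow_natCast]; simp; ring
    have z4 : q ^ ((n : ℤ) - j) = q ^ n * (q ^ j)⁻¹ := by
      rw [zpow_sub₀ hq0, zpow_natCast]; ring
    rw [z1, z2, z3, z4]
    rw [zpow_neg] at t1
    have hz : q ^ j ≠ 0 := zpow_ne_zero _ hq0
    generalize q ^ j = z at *
    generalize invQFac q ((n : ℤ) + 1 + j) = A at *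
    generalize invQFac q ((n : ℤ) + 1 - j) = B at *
    generalize thetaTerm x q j = T at *
    generalize thetaTerm x q (j - 1) = T' at *
    generalize qPoch q q (2 * n) = P at *
    have e4 : q ^ (2 * n) = q ^ n * q ^ n := by ring
    rw [show 2 * n + 1 = (2 * n).succ from rfl, pow_succ, pow_succ, e4]
    generalize q ^ n = w at *
    rw [show T' = -(q * z⁻¹) * T / x by rw [← t1]; field_simp]
    field_simp
    ring

/-! ### Gaussian majorants -/

theorem summable_nat_pow_sq_mul_pow {θ B : ℝ} (h0 : 0 < θ) (h1 : θ < 1) (hB : 0 < B) :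
    Summable fun n : ℕ => θ ^ n ^ 2 * B ^ n := by
  have ht : Tendsto (fun n : ℕ => θ ^ n * B) atTop (𝓝 0) := by
    simpa using (tendsto_pow_atTop_nhds_zero_of_lt_one h0.le h1).mul_const B
  refine Summable.of_norm_bounded_eventually_nat (g := fun n => (1 / 2 : ℝ) ^ n)
    (summable_geometric_of_lt_one (by norm_num) (by norm_num)) ?_
  filter_upwards [ht.eventually_le_const (show (0 : ℝ) < 1 / 2 by norm_num)] with n hn
  rw [Real.norm_of_nonneg (by positivity), sq, pow_mul, ← mul_pow]
  exact pow_le_pow_left₀ (by positivity) hn n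

/-- Gaussian decay `θ^(j²)` beats every exponential growth `B^|j|`. -/
theorem summable_zpow_sq_mul_zpow_abs {θ B : ℝ} (h0 : 0 < θ) (h1 : θ < 1) (hB : 0 < B) :
    Summable fun j : ℤ => θ ^ j ^ 2 * B ^ |j| := by
  have h := summable_nat_pow_sq_mul_pow h0 h1 hB
  refine Summable.of_nat_of_neg (h.congr fun n => ?_) (h.congr fun n => ?_) <;>
  · simp only [even_two, Even.neg_pow, abs_neg, Nat.abs_cast, zpow_natCast]
    rw [← Nat.cast_pow, zpow_natCast]

theorem summable_zpow_abs {θ : ℝ} (h0 : 0 < θ) (h1 : θ < 1) : Summable fun j : ℤ => θ ^ |j| := by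
  have h := summable_geometric_of_lt_one h0.le h1
  refine Summable.of_nat_of_neg (h.congr fun n => ?_) (h.congr fun n => ?_) <;> simp

theorem zpow_le_max_inv_zpow_abs {X : ℝ} (hX : 0 < X) (j : ℤ) : X ^ j ≤ max X X⁻¹ ^ |j| := by
  rcases abs_cases j with ⟨h, hj⟩ | ⟨h, hj⟩ <;> rw [h]
  · exact zpow_le_zpow_left₀ hj hX.le (le_max_left _ _)
  · rw [show X ^ j = X⁻¹ ^ (-j) by rw [inv_zpow, zpow_neg, inv_inv]]
    exact zpow_le_zpow_left₀ (by omega) (inv_nonneg.2 hX.le) (le_max_right _ _)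

theorem norm_neg_one_zpow (j : ℤ) : ‖(-1 : ℂ) ^ j‖ = 1 := by simp

theorem norm_sg₂_le (r s : ℤ) : ‖sg₂ r s‖ ≤ 1 := by
  unfold sg₂ sg
  split_ifs <;> norm_num

/-- `sg₂` vanishes unless both arguments have the same sign. -/
theorem sg₂_eq_zero_or (r s : ℤ) :
    sg₂ r s = 0 ∨ (0 ≤ r ∧ 0 ≤ s) ∨ (r ≤ -1 ∧ s ≤ -1) := by
  unfold sg₂ sg
  by_cases hr : 0 ≤ r <;> by_cases hs : 0 ≤ s <;> simp [hr, hs]; omega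

theorem norm_zpow_le_sqrt_zpow {q : ℂ} (hq0 : q ≠ 0) (hq : ‖q‖ < 1) {n k : ℤ} (h : k ≤ 2 * n) :
    ‖q ^ n‖ ≤ √‖q‖ ^ k := by
  have h0 : 0 < ‖q‖ := norm_pos_iff.2 hq0
  have h1 : ‖q ^ n‖ = √‖q‖ ^ (2 * n) := by
    rw [norm_zpow, zpow_mul]
    congr 1
    exact (Real.sq_sqrt h0.le).symm
  rw [h1]
  exact zpow_le_zpow_right_of_le_one₀ (Real.sqrt_pos.2 h0) (Real.sqrt_le_one.2 hq.le) h

theorem summable_thetaTerm {x q : ℂ} (hq0 : q ≠ 0) (hq : ‖q‖ < 1) (hx0 : x ≠ 0) :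
    Summable fun j => ‖thetaTerm x q j‖ := by
  have h0 : 0 < √‖q‖ := Real.sqrt_pos.2 (norm_pos_iff.2 hq0)
  have h1 : √‖q‖ < 1 := (Real.sqrt_lt' one_pos).2 (by simpa using hq)
  have hX : 0 < ‖x‖ := norm_pos_iff.2 hx0
  refine (summable_zpow_sq_mul_zpow_abs h0 h1
    (B := (√‖q‖)⁻¹ * max ‖x‖ ‖x‖⁻¹) (by positivity)).of_nonneg_of_le
    (fun _ => norm_nonneg _) fun j => ?_
  have e : j ^ 2 + -|j| ≤ 2 * binomTwo j := by
    rw [two_mul_binomTwo]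
    nlinarith [le_abs_self j]
  have := norm_zpow_le_sqrt_zpow hq0 hq e
  rw [zpow_add₀ h0.ne', zpow_neg, ← inv_zpow] at this
  rw [thetaTerm, norm_mul, norm_mul, norm_neg_one_zpow, one_mul, norm_zpow, mul_zpow]
  calc _ ≤ max ‖x‖ ‖x‖⁻¹ ^ |j| * (√‖q‖ ^ j ^ 2 * (√‖q‖)⁻¹ ^ |j|) :=
        mul_le_mul (zpow_le_max_inv_zpow_abs hX j) this (norm_nonneg _) (by positivity)
    _ = _ := by ring

/-! ### The Jacobi triple product -/

/-- The Jacobi triple product: the coefficients of the finite form converge, boundedly, to the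
constant `1/(q;q)_∞`. -/
theorem hasSum_thetaTerm {x q : ℂ} (hq0 : q ≠ 0) (hq : ‖q‖ < 1) (hx0 : x ≠ 0) :
    HasSum (thetaTerm x q) (Theta x q) := by
  obtain ⟨C, hC0, hC⟩ := exists_norm_invQFac_le hq
  obtain ⟨D, hD⟩ := (Metric.isBounded_range_of_tendsto _ (tendsto_qPoch q hq)).exists_norm_le
  have hD0 : 0 ≤ D := (norm_nonneg _).trans (hD _ ⟨0, rfl⟩)
  have hP := qPochInf_self_ne_zero hq
  have hs := summable_thetaTerm hq0 hq hx0
  have hlim : ∀ j : ℤ, Tendsto (fun n : ℕ =>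
      qPoch q q (2 * n) * (invQFac q (n + j) * invQFac q (n - j)) * thetaTerm x q j) atTop
      (𝓝 (qPochInf q q * ((qPochInf q q)⁻¹ * (qPochInf q q)⁻¹) * thetaTerm x q j)) := by
    intro j
    refine ((((tendsto_qPoch q hq).comp ?_).mul (((tendsto_invQFac hq).comp ?_).mul
      ((tendsto_invQFac hq).comp ?_))).mul_const _)
    · exact tendsto_atTop_mono (fun n => show n ≤ 2 * n by omega) tendsto_id
    · exact tendsto_atTop_add_const_right _ j tendsto_natCast_atTop_atTop
    · exact tendsto_atTop_add_const_right _ (-j) tendsto_natCast_atTop_atTop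
  have key := tendsto_tsum_of_dominated_convergence (hs.mul_left (D * (C * C))) hlim
    (Eventually.of_forall fun n j => by
      rw [norm_mul, norm_mul, norm_mul]
      gcongr
      · exact hD _ ⟨_, rfl⟩
      · exact hC _
      · exact hC _)
  have h2 : Tendsto (fun n => qPoch x q n * qPoch (q / x) q n) atTop
      (𝓝 (qPochInf x q * qPochInf (q / x) q)) :=
    (tendsto_qPoch x hq).mul (tendsto_qPoch (q / x) hq)
  have h3 := tendsto_nhds_unique h2
    (key.congr fun n => (hasSum_finite_tripleProduct hq0 hq hx0 n).tsum_eq)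
  rw [tsum_mul_left] at h3
  have h4 : ∑' j, thetaTerm x q j = Theta x q := by
    rw [Theta, h3]
    field_simp
  exact h4 ▸ hs.of_norm.hasSum

/-- The bilateral theta series vanishes at integral powers of `q`, because the involution
`j ↦ 1 - 2n - j` negates its terms. -/
theorem tsum_thetaTerm_zpow {q : ℂ} (hq0 : q ≠ 0) (n : ℤ) : ∑' j, thetaTerm (q ^ n) q j = 0 := by
  have h : ∑' j, thetaTerm (q ^ n) q j = -∑' j, thetaTerm (q ^ n) q j := by
    conv_lhs => rw [← (Equiv.subLeft (1 - 2 * n)).tsum_eq]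
    rw [← tsum_neg]
    refine tsum_congr fun j => ?_
    have e : n * (1 - 2 * n - j) + binomTwo (1 - 2 * n - j) = n * j + binomTwo j := by
      have h1 := two_mul_binomTwo j
      have h2 := two_mul_binomTwo (1 - 2 * n - j)
      linarith
    have hs : (-1 : ℂ) ^ (1 - 2 * n - j) = -(-1) ^ j := by
      rw [zpow_sub₀ (by norm_num), zpow_sub₀ (by norm_num), zpow_mul]
      rcases Int.even_or_odd j with hj | hj <;> simp [hj.neg_one_zpow]
    simp only [thetaTerm, Equiv.subLeft_apply, ← zpow_mul, mul_assoc, ← zpow_add₀ hq0, e, hs,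
      neg_mul]
  exact self_eq_neg.1 h

/-- The majorant in one variable that controls the Hecke-type terms. -/
theorem summable_zpow_gaussian {θ X : ℝ} (h0 : 0 < θ) (h1 : θ < 1) (hX : 0 < X) (D : ℤ) :
    Summable fun j : ℤ => θ ^ (j ^ 2 - D * |j|) * X ^ j := by
  refine (summable_zpow_sq_mul_zpow_abs h0 h1
    (B := (θ ^ D)⁻¹ * max X X⁻¹) (by positivity)).of_nonneg_of_le
    (fun _ => by positivity) fun j => ?_
  rw [zpow_sub₀ h0.ne', zpow_mul, mul_zpow, inv_zpow, div_eq_mul_inv, ← mul_assoc]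
  exact mul_le_mul_of_nonneg_left (zpow_le_max_inv_zpow_abs hX j) (by positivity)

theorem summable_heckeTerm {a b c : ℤ} (ha : 1 ≤ a) (hb : 0 ≤ b) (hc : 1 ≤ c) {x y q : ℂ}
    (hq0 : q ≠ 0) (hq : ‖q‖ < 1) (hx0 : x ≠ 0) (hy0 : y ≠ 0) :
    Summable (heckeTerm a b c x y q) := by
  have h0 : 0 < √‖q‖ := Real.sqrt_pos.2 (norm_pos_iff.2 hq0)
  have h1 : √‖q‖ < 1 := (Real.sqrt_lt' one_pos).2 (by simpa using hq)
  have hX : 0 < ‖x‖ := norm_pos_iff.2 hx0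
  have hY : 0 < ‖y‖ := norm_pos_iff.2 hy0
  refine Summable.of_norm_bounded ((summable_zpow_gaussian h0 h1 hX 1).mul_of_nonneg
    (summable_zpow_gaussian h0 h1 hY 1) (fun _ => by positivity) (fun _ => by positivity)) ?_
  rintro ⟨r, s⟩
  rcases sg₂_eq_zero_or r s with h | h
  · simp only [heckeTerm, h, zero_mul, norm_zero]
    positivity
  have hrs : 0 ≤ r * s := by
    rcases h with ⟨h, h'⟩ | ⟨h, h'⟩
    · exact mul_nonneg h h'
    · exact mul_nonneg_of_nonpos_of_nonpos (by omega) (by omega)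
  have hsq : ∀ n : ℤ, n ^ 2 - 1 * |n| ≤ 2 * binomTwo n ∧ 0 ≤ binomTwo n := fun n => by
    have := two_mul_binomTwo n
    refine ⟨by nlinarith [le_abs_self n], ?_⟩
    rcases le_or_gt n 0 with h | h <;> nlinarith
  have e : (r ^ 2 - 1 * |r|) + (s ^ 2 - 1 * |s|) ≤
      2 * (a * binomTwo r + b * r * s + c * binomTwo s) := by
    have := mul_nonneg hb hrs
    nlinarith [hsq r, hsq s, mul_nonneg (sub_nonneg.2 ha) (hsq r).2,
      mul_nonneg (sub_nonneg.2 hc) (hsq s).2]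
  have := norm_zpow_le_sqrt_zpow hq0 hq e
  rw [zpow_add₀ h0.ne'] at this
  simp only [heckeTerm]
  rw [norm_mul, norm_mul, norm_mul, norm_mul, norm_neg_one_zpow, mul_one, norm_zpow, norm_zpow]
  calc _ ≤ 1 * ‖x‖ ^ r * ‖y‖ ^ s * (√‖q‖ ^ (r ^ 2 - 1 * |r|) * √‖q‖ ^ (s ^ 2 - 1 * |s|)) := by
        gcongr
        exact norm_sg₂_le r s
    _ = _ := by ring

/-! ### Shift relations of Hecke-type double sums -/

theorem sg₂_comm (r s : ℤ) : sg₂ r s = sg₂ s r := by rw [sg₂, sg₂, add_comm]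

theorem heckeF_comm (a b c : ℤ) (x y q : ℂ) : heckeF a b c x y q = heckeF c b a y x q := by
  rw [heckeF, heckeF, ← (Equiv.prodComm ℤ ℤ).tsum_eq]
  refine tsum_congr fun p => ?_
  simp only [heckeTerm, Equiv.prodComm_apply, Prod.fst_swap, Prod.snd_swap]
  rw [sg₂_comm, add_comm p.2, show a * binomTwo p.2 + b * p.2 * p.1 + c * binomTwo p.1 =
    c * binomTwo p.1 + b * p.1 * p.2 + a * binomTwo p.2 by ring]
  ring

theorem sg₂_add_one_left (r s : ℤ) : sg₂ (r + 1) s = sg₂ r s + if r = -1 then 1 else 0 := by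
  unfold sg₂ sg
  rcases lt_trichotomy r (-1) with h | rfl | h
  · rw [if_neg (by omega), if_neg (show ¬ 0 ≤ r by omega), if_neg (show r ≠ -1 by omega), add_zero]
  · simp
    ring
  · rw [if_pos (by omega), if_pos (show 0 ≤ r by omega), if_neg (show r ≠ -1 by omega), add_zero]

/-- Moving the summation index `r` by one changes `sg₂ r s` only on the line `r = -1`, so it turns
the double sum into a translate of itself up to a theta series. -/
theorem heckeF_shift_left {a b c : ℤ} (ha : 1 ≤ a) (hb : 0 ≤ b) (hc : 1 ≤ c) {x y q : ℂ}
    (hq0 : q ≠ 0) (hq : ‖q‖ < 1) (hx0 : x ≠ 0) (hy0 : y ≠ 0) :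
    heckeF a b c x y q = -x * heckeF a b c (x * q ^ a) (y * q ^ b) q +
      ∑' s : ℤ, (-1) ^ s * y ^ s * q ^ (c * binomTwo s) := by
  let e : ℤ × ℤ ≃ ℤ × ℤ := (Equiv.addRight (1 : ℤ)).prodCongr (Equiv.refl ℤ)
  have hS := summable_heckeTerm ha hb hc hq0 hq hx0 hy0
  have hS' := (summable_heckeTerm ha hb hc hq0 hq (x := x * q ^ a) (y := y * q ^ b)
    (mul_ne_zero hx0 (zpow_ne_zero _ hq0)) (mul_ne_zero hy0 (zpow_ne_zero _ hq0))).mul_left (-x)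
  have hterm : ∀ p : ℤ × ℤ, heckeTerm a b c x y q (e p) -
      -x * heckeTerm a b c (x * q ^ a) (y * q ^ b) q p =
      if p.1 = -1 then (-1) ^ p.2 * y ^ p.2 * q ^ (c * binomTwo p.2) else 0 := by
    rintro ⟨r, s⟩
    have hexp : q ^ (a * binomTwo (r + 1) + b * (r + 1) * s + c * binomTwo s) =
        (q ^ a) ^ r * (q ^ b) ^ s * q ^ (a * binomTwo r + b * r * s + c * binomTwo s) := by
      rw [← zpow_mul, ← zpow_mul, ← zpow_add₀ hq0, ← zpow_add₀ hq0, binomTwo_add_one]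
      ring_nf
    simp only [e, Equiv.prodCongr_apply, Prod.map, Equiv.coe_addRight, Equiv.refl_apply, heckeTerm]
    rw [sg₂_add_one_left, hexp, mul_zpow, mul_zpow, zpow_add₀ hx0, zpow_one,
      show r + 1 + s = r + s + 1 by ring, zpow_add_one₀ (by norm_num)]
    split_ifs with h
    · subst h
      have : q ^ (a * binomTwo (-1) + b * -1 * s + c * binomTwo s) =
          q ^ a * ((q ^ b) ^ s)⁻¹ * q ^ (c * binomTwo s) := by
        rw [← zpow_mul, ← zpow_neg, ← zpow_add₀ hq0, ← zpow_add₀ hq0,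
          show binomTwo (-1) = 1 from rfl]
        ring_nf
      have h1 : q ^ a ≠ 0 := zpow_ne_zero _ hq0
      have h2 : (q ^ b) ^ s ≠ 0 := zpow_ne_zero _ (zpow_ne_zero _ hq0)
      rw [this, zpow_add₀ (by norm_num)]
      simp only [zpow_neg, zpow_one]
      field_simp
      ring
    · ring
  have hS1 : Summable fun p => heckeTerm a b c x y q (e p) := e.summable_iff.2 hS
  have h1 : heckeF a b c x y q - -x * heckeF a b c (x * q ^ a) (y * q ^ b) q =
      ∑' p : ℤ × ℤ, if p.1 = -1 then (-1) ^ p.2 * y ^ p.2 * q ^ (c * binomTwo p.2) else 0 := by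
    rw [heckeF, heckeF, ← tsum_mul_left, ← e.tsum_eq (heckeTerm a b c x y q),
      ← hS1.tsum_sub hS']
    exact tsum_congr hterm
  rw [← sub_eq_iff_eq_add', h1]
  have hinj : Function.Injective fun s : ℤ => ((-1, s) : ℤ × ℤ) := fun s s' h => by simpa using h
  rw [← hinj.tsum_eq]
  · simp
  · rintro ⟨r, s⟩ h
    refine ⟨s, ?_⟩
    by_contra hr
    simp only [Prod.mk.injEq, and_true] at hr
    exact h (if_neg (Ne.symm hr))

theorem heckeF_shift_right {a b c : ℤ} (ha : 1 ≤ a) (hb : 0 ≤ b) (hc : 1 ≤ c) {x y q : ℂ}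
    (hq0 : q ≠ 0) (hq : ‖q‖ < 1) (hx0 : x ≠ 0) (hy0 : y ≠ 0) :
    heckeF a b c x y q = -y * heckeF a b c (x * q ^ b) (y * q ^ c) q +
      ∑' r : ℤ, (-1) ^ r * x ^ r * q ^ (a * binomTwo r) := by
  rw [heckeF_comm, heckeF_shift_left hc hb ha hq0 hq hy0 hx0, heckeF_comm c b a]

theorem Theta_div_self {x q : ℂ} (hq0 : q ≠ 0) : Theta (q / x) q = Theta x q := by
  rw [Theta, Theta, div_div_cancel₀ hq0, mul_comm (qPochInf (q / x) q)]

/-- The case `a = b = c = 1`: with both arguments moved by `q`, either shift gives the same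
function, so it is a quotient of a theta function by a linear factor. -/
theorem heckeF_one_one_one {x q : ℂ} (hq0 : q ≠ 0) (hq : ‖q‖ < 1) (hx0 : x ≠ 0)
    (hx : ∀ n : ℤ, x ≠ q ^ n) (r : ℤ) :
    heckeF 1 1 1 (q / x) (q ^ (r + 1)) q = Theta x q / (1 - x * q ^ r) := by
  have hX : q / x ≠ 0 := div_ne_zero hq0 hx0
  have hY : q ^ (r + 1) ≠ 0 := zpow_ne_zero _ hq0
  have h1 := heckeF_shift_left le_rfl zero_le_one le_rfl hq0 hq hX hY
  have h2 := heckeF_shift_right le_rfl zero_le_one le_rfl hq0 hq hX hY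
  have t1 : ∑' s : ℤ, (-1) ^ s * (q ^ (r + 1)) ^ s * q ^ (1 * binomTwo s) = 0 := by
    simpa only [thetaTerm, one_mul] using tsum_thetaTerm_zpow hq0 (r + 1)
  have t2 : ∑' s : ℤ, (-1) ^ s * (q / x) ^ s * q ^ (1 * binomTwo s) = Theta x q := by
    simpa only [thetaTerm, one_mul, Theta_div_self hq0] using (hasSum_thetaTerm hq0 hq hX).tsum_eq
  rw [t1, add_zero] at h1
  rw [t2] at h2
  have hne : 1 - x * q ^ r ≠ 0 := by
    refine sub_ne_zero.2 fun h => hx (-r) ?_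
    rw [zpow_neg]
    exact eq_inv_of_mul_eq_one_left h.symm
  rw [eq_div_iff hne]
  generalize heckeF 1 1 1 (q / x * q ^ (1 : ℤ)) (q ^ (r + 1) * q ^ (1 : ℤ)) q = F at h1 h2
  generalize heckeF 1 1 1 (q / x) (q ^ (r + 1)) q = G at h1 h2 ⊢
  rw [zpow_add_one₀ hq0] at h2
  have h3 : q * F = -x * G := by rw [h1]; field_simp
  linear_combination h2 - q ^ r * h3

/-! ### Quasi-periodicity at integral powers of `q` -/

section Periodicity

variable {q : ℂ} {t : ℤ}

theorem heckeF_zpow_shift_left (hq0 : q ≠ 0) (hq : ‖q‖ < 1) (ht : 1 ≤ t) (u v : ℤ) :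
    heckeF 1 (2 * t) 1 (q ^ u) (q ^ v) q =
      -q ^ u * heckeF 1 (2 * t) 1 (q ^ (u + 1)) (q ^ (v + 2 * t)) q := by
  rw [heckeF_shift_left le_rfl (by omega) le_rfl hq0 hq (zpow_ne_zero u hq0) (zpow_ne_zero v hq0),
    ← zpow_add₀ hq0, ← zpow_add₀ hq0]
  simpa only [thetaTerm, one_mul, add_eq_left] using tsum_thetaTerm_zpow hq0 v

theorem heckeF_zpow_shift_right (hq0 : q ≠ 0) (hq : ‖q‖ < 1) (ht : 1 ≤ t) (u v : ℤ) :
    heckeF 1 (2 * t) 1 (q ^ u) (q ^ v) q =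
      -q ^ v * heckeF 1 (2 * t) 1 (q ^ (u + 2 * t)) (q ^ (v + 1)) q := by
  rw [heckeF_comm, heckeF_zpow_shift_left hq0 hq ht, heckeF_comm]

theorem heckeF_zpow_shift_right_iterate (hq0 : q ≠ 0) (hq : ‖q‖ < 1) (ht : 1 ≤ t) (u v : ℤ)
    (n : ℕ) : heckeF 1 (2 * t) 1 (q ^ u) (q ^ v) q =
      (-1) ^ n * q ^ (n * v + binomTwo n) *
        heckeF 1 (2 * t) 1 (q ^ (u + 2 * t * n)) (q ^ (v + n)) q := by
  induction n with
  | zero => simp [binomTwo]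
  | succ n ih =>
    rw [ih, heckeF_zpow_shift_right hq0 hq ht (u + 2 * t * n)]
    push_cast
    rw [binomTwo_add_one, show u + 2 * t * n + 2 * t = u + 2 * t * (n + 1) by ring,
      show ((n : ℤ) + 1) * v + (binomTwo n + n) = (n * v + binomTwo n) + (v + n) by ring,
      zpow_add₀ hq0 _ (v + n), add_assoc v]
    ring

/-- Combining one step in `r` with `2t` steps back in `s` fixes the second argument. -/
theorem heckeF_zpow_period (hq0 : q ≠ 0) (hq : ‖q‖ < 1) (ht : 1 ≤ t) (u v : ℤ) :
    heckeF 1 (2 * t) 1 (q ^ (u + (4 * t ^ 2 - 1))) (q ^ v) q =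
      -q ^ (u + (4 * t ^ 2 - 1) - 2 * t * v - t * (2 * t - 1)) *
        heckeF 1 (2 * t) 1 (q ^ u) (q ^ v) q := by
  have h1 := heckeF_zpow_shift_left hq0 hq ht (u + (4 * t ^ 2 - 1)) v
  have h2 := heckeF_zpow_shift_right_iterate hq0 hq ht u v (2 * t).toNat
  have e : (((2 * t).toNat : ℕ) : ℤ) = 2 * t := by omega
  have hb : binomTwo (2 * t) = t * (2 * t - 1) := by
    have := two_mul_binomTwo (2 * t)
    linarith
  have hs : (-1 : ℂ) ^ (2 * t).toNat = 1 := by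
    apply Even.neg_one_pow
    exact ⟨t.toNat, by omega⟩
  rw [e, hs, hb, one_mul, show u + 2 * t * (2 * t) = u + (4 * t ^ 2 - 1) + 1 by ring] at h2
  rw [h1, h2, show u + (4 * t ^ 2 - 1) = u + (4 * t ^ 2 - 1) - 2 * t * v - t * (2 * t - 1) +
    (2 * t * v + t * (2 * t - 1)) by ring, zpow_add₀ hq0 (_ - _)]
  ring_nf

/-- The quasi-periodicity of `u ↦ f_{1,2t,1}(q^u, q^v; q)` with period `4t² - 1`. -/
theorem heckeF_zpow_quasiperiodic (hq0 : q ≠ 0) (hq : ‖q‖ < 1) (ht : 1 ≤ t) (u v s : ℤ) :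
    heckeF 1 (2 * t) 1 (q ^ (u + (4 * t ^ 2 - 1) * s)) (q ^ v) q =
      (-1) ^ s * q ^ (s * (u + (4 * t ^ 2 - 1) - 2 * t * v - t * (2 * t - 1)) +
        (4 * t ^ 2 - 1) * binomTwo s) * heckeF 1 (2 * t) 1 (q ^ u) (q ^ v) q := by
  -- The ratio of consecutive values has the same form at every index.
  have step : ∀ s : ℤ, heckeF 1 (2 * t) 1 (q ^ (u + (4 * t ^ 2 - 1) * (s + 1))) (q ^ v) q =
      -q ^ (u + (4 * t ^ 2 - 1) - 2 * t * v - t * (2 * t - 1) + (4 * t ^ 2 - 1) * s) *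
        heckeF 1 (2 * t) 1 (q ^ (u + (4 * t ^ 2 - 1) * s)) (q ^ v) q := fun s => by
    have := heckeF_zpow_period hq0 hq ht (u + (4 * t ^ 2 - 1) * s) v
    rw [show u + (4 * t ^ 2 - 1) * (s + 1) = u + (4 * t ^ 2 - 1) * s + (4 * t ^ 2 - 1) by ring,
      this]
    ring_nf
  have factor : ∀ s : ℤ, (-1 : ℂ) ^ (s + 1) *
      q ^ ((s + 1) * (u + (4 * t ^ 2 - 1) - 2 * t * v - t * (2 * t - 1)) +
        (4 * t ^ 2 - 1) * binomTwo (s + 1)) =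
      -q ^ (u + (4 * t ^ 2 - 1) - 2 * t * v - t * (2 * t - 1) + (4 * t ^ 2 - 1) * s) *
        ((-1) ^ s * q ^ (s * (u + (4 * t ^ 2 - 1) - 2 * t * v - t * (2 * t - 1)) +
        (4 * t ^ 2 - 1) * binomTwo s)) := fun s => by
    rw [binomTwo_add_one, zpow_add_one₀ (by norm_num), show (s + 1) *
      (u + (4 * t ^ 2 - 1) - 2 * t * v - t * (2 * t - 1)) + (4 * t ^ 2 - 1) * (binomTwo s + s) =
      (u + (4 * t ^ 2 - 1) - 2 * t * v - t * (2 * t - 1) + (4 * t ^ 2 - 1) * s) +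
      (s * (u + (4 * t ^ 2 - 1) - 2 * t * v - t * (2 * t - 1)) +
        (4 * t ^ 2 - 1) * binomTwo s) by ring, zpow_add₀ hq0]
    ring
  induction s with
  | zero => simp [binomTwo]
  | succ n ih => rw [step, ih, factor]; ring
  | pred n ih =>
    have h1 := step (-n - 1)
    have h2 := factor (-n - 1)
    rw [sub_add_cancel] at h1 h2
    rw [h1, h2, mul_assoc (-q ^ _)] at ih
    exact mul_left_cancel₀ (neg_ne_zero.2 (zpow_ne_zero _ hq0)) ih

end Periodicity

/-! ### The fourfold series and its absolute convergence -/

/-- The term of the fourfold series obtained from `Θ(x;q) g_{t,m}(x;q)` by expanding each quotient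
`Θ(x;q) / (1 - x q^r)` as a double series `f_{1,1,1}`; its index is `((r, s), (a, i))`. -/
def quadTerm (t m : ℤ) (x q : ℂ) (p p' : ℤ × ℤ) : ℂ :=
  sg₂ p.1 p.2 * ((-1) ^ (p.1 + p.2) * q ^ gExponent t m p.1 p.2) *
    heckeTerm 1 1 1 (q / x) (q ^ (p.1 + 1)) q p'

theorem quadTerm_eq {t m : ℤ} {x q : ℂ} (hq0 : q ≠ 0) (r s a i : ℤ) :
    quadTerm t m x q (r, s) (a, i) = sg₂ r s * sg₂ a i * (-1) ^ (r + s) * (-1) ^ (a + i) *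
      x⁻¹ ^ a * q ^ (gExponent t m r s + r * i + binomTwo (a + i + 1)) := by
  have e : gExponent t m r s + r * i + binomTwo (a + i + 1) = gExponent t m r s + a + (r + 1) * i +
      (1 * binomTwo a + 1 * a * i + 1 * binomTwo i) := by
    rw [binomTwo_add_one, binomTwo_add]
    ring
  rw [e, zpow_add₀ hq0, zpow_add₀ hq0, zpow_add₀ hq0, zpow_mul]
  simp only [quadTerm, heckeTerm]
  rw [div_eq_mul_inv, mul_zpow]
  ring

/-- The exponent of `q` in the fourfold series grows in all four directions. The squares only
contribute `(r + i)²` to the growth in `r` and `i`, which is nothing along `i = -r`, so linear terms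
must do the work. This is where the range of `m` enters: the lower bound `-t ≤ m` makes the linear
part increase with `|r|` when `r ≥ 0`, the upper bound `m ≤ 3t - 2` when `r < 0`. -/
theorem le_two_mul_quadExponent {t m : ℤ} (ht : 1 ≤ t) (hm₁ : -t ≤ m) (hm₂ : m ≤ 3 * t - 2)
    (htm : t ≡ m [ZMOD 2]) {r s a i : ℤ} (hrs : (0 ≤ r ∧ 0 ≤ s) ∨ (r ≤ -1 ∧ s ≤ -1))
    (hai : (0 ≤ a ∧ 0 ≤ i) ∨ (a ≤ -1 ∧ i ≤ -1)) :
    (|r| + (s ^ 2 - |t + 1 - m| * |s|)) + ((a ^ 2 - 1 * |a|) + |i|) ≤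
      2 * (gExponent t m r s + r * i + binomTwo (a + i + 1)) := by
  have h1 := two_mul_gExponent htm r s
  have h2 := two_mul_binomTwo (a + i + 1)
  have h3 : -(|t + 1 - m| * |s|) ≤ (t + 1 - m) * s := by
    rw [← abs_mul]
    exact neg_abs_le _
  -- The part of the exponent in `r` and `s` other than `r²`, `s²` and the linear term in `s`.
  have h4 : |r| ≤ 4 * t * r * s + (t + 1 + m) * r := by
    rcases hrs with ⟨hr, hs⟩ | ⟨hr, hs⟩
    · rw [abs_of_nonneg hr]
      have := mul_nonneg (mul_nonneg (by omega : 0 ≤ 4 * t) hr) hs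
      nlinarith
    · rw [abs_of_neg (by omega)]
      have := mul_nonneg (mul_nonneg (by omega : 0 ≤ 4 * t) (by omega : 0 ≤ -r))
        (by omega : 0 ≤ -1 - s)
      nlinarith
  have h5 : a ^ 2 - 1 * |a| + |i| ≤ a ^ 2 + 2 * a * i + a + i := by
    rcases hai with ⟨ha, hi⟩ | ⟨ha, hi⟩
    · rw [abs_of_nonneg ha, abs_of_nonneg hi]
      nlinarith [mul_nonneg ha hi]
    · rw [abs_of_neg (by omega : a < 0), abs_of_neg (by omega : i < 0)]
      nlinarith [mul_nonneg (by omega : 0 ≤ -1 - a) (by omega : 0 ≤ -i)]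
  nlinarith [sq_nonneg (r + i)]

theorem summable_quadTerm {t m : ℤ} (ht : 1 ≤ t) (hm₁ : -t ≤ m) (hm₂ : m ≤ 3 * t - 2)
    (htm : t ≡ m [ZMOD 2]) {x q : ℂ} (hq0 : q ≠ 0) (hq : ‖q‖ < 1) (hx0 : x ≠ 0) :
    Summable (Function.uncurry (quadTerm t m x q)) := by
  have h0 : 0 < √‖q‖ := Real.sqrt_pos.2 (norm_pos_iff.2 hq0)
  have h1 : √‖q‖ < 1 := (Real.sqrt_lt' one_pos).2 (by simpa using hq)
  have hX : 0 < ‖x‖⁻¹ := inv_pos.2 (norm_pos_iff.2 hx0)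
  have hs₁ := (summable_zpow_abs h0 h1).mul_of_nonneg
    (summable_zpow_gaussian h0 h1 one_pos |t + 1 - m|) (fun _ => by positivity)
    (fun _ => by positivity)
  have hs₂ := (summable_zpow_gaussian h0 h1 hX 1).mul_of_nonneg (summable_zpow_abs h0 h1)
    (fun _ => by positivity) (fun _ => by positivity)
  refine Summable.of_norm_bounded (hs₁.mul_of_nonneg hs₂ (fun _ => by positivity)
    (fun _ => by positivity)) ?_
  rintro ⟨⟨r, s⟩, ⟨a, i⟩⟩
  rw [Function.uncurry_apply_pair, quadTerm_eq hq0]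
  rcases sg₂_eq_zero_or r s with hrs | hrs
  · simp only [hrs, zero_mul, norm_zero]
    positivity
  rcases sg₂_eq_zero_or a i with hai | hai
  · simp only [hai, zero_mul, mul_zero, norm_zero]
    positivity
  have := norm_zpow_le_sqrt_zpow hq0 hq (le_two_mul_quadExponent ht hm₁ hm₂ htm hrs hai)
  rw [zpow_add₀ h0.ne', zpow_add₀ h0.ne', zpow_add₀ h0.ne'] at this
  rw [norm_mul, norm_mul, norm_mul, norm_mul, norm_mul, norm_neg_one_zpow, norm_neg_one_zpow,
    mul_one, mul_one, norm_zpow, norm_inv]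
  calc _ ≤ 1 * 1 * ‖x‖⁻¹ ^ a * (√‖q‖ ^ |r| * √‖q‖ ^ (s ^ 2 - |t + 1 - m| * |s|) *
        (√‖q‖ ^ (a ^ 2 - 1 * |a|) * √‖q‖ ^ |i|)) := by
        gcongr
        · exact norm_sg₂_le r s
        · exact norm_sg₂_le a i
    _ = _ := by
      simp only [one_zpow]
      ring

/-! ### Summation to the Hecke–Appell series -/

/-- A series weighted by `sg₂` is the difference of its sums over two quadrants. -/
theorem tsum_sg₂_mul {F : ℤ → ℤ → ℂ} (h : Summable fun p : ℤ × ℤ => sg₂ p.1 p.2 * F p.1 p.2) :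
    Summable (fun p : ℕ × ℕ => F p.1 p.2) ∧ Summable (fun p : ℕ × ℕ => F (-1 - p.1) (-1 - p.2)) ∧
      ∑' p : ℤ × ℤ, sg₂ p.1 p.2 * F p.1 p.2 =
        ∑' p : ℕ × ℕ, F p.1 p.2 - ∑' p : ℕ × ℕ, F (-1 - p.1) (-1 - p.2) := by
  let i₁ : ℕ × ℕ → ℤ × ℤ := fun p => (p.1, p.2)
  let i₂ : ℕ × ℕ → ℤ × ℤ := fun p => (-1 - p.1, -1 - p.2)
  have hi₁ : Function.Injective i₁ := by
    rintro ⟨a, b⟩ ⟨c, d⟩ h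
    simp only [i₁, Prod.mk.injEq] at h ⊢
    omega
  have hi₂ : Function.Injective i₂ := by
    rintro ⟨a, b⟩ ⟨c, d⟩ h
    simp only [i₂, Prod.mk.injEq] at h ⊢
    omega
  have s₁ : Summable fun p : ℕ × ℕ => F p.1 p.2 :=
    (h.comp_injective hi₁).congr fun p => by simp [i₁, sg₂, sg]
  have s₂ : Summable fun p : ℕ × ℕ => F (-1 - p.1) (-1 - p.2) := by
    refine (h.comp_injective hi₂).neg.congr fun p => ?_
    have h1 : ¬ (0 : ℤ) ≤ -1 - p.1 := by omega
    have h2 : ¬ (0 : ℤ) ≤ -1 - p.2 := by omega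
    simp only [Function.comp_apply, i₂, sg₂, sg, if_neg h1, if_neg h2]
    ring
  refine ⟨s₁, s₂, ?_⟩
  have t₁ : HasSum (fun p : ℤ × ℤ => if 0 ≤ p.1 ∧ 0 ≤ p.2 then F p.1 p.2 else 0)
      (∑' p : ℕ × ℕ, F p.1 p.2) := by
    refine (hi₁.hasSum_iff ?_).1 (s₁.hasSum.congr_fun ?_)
    · rintro ⟨r, s⟩ hp
      refine if_neg fun h' => hp ⟨(r.toNat, s.toNat), ?_⟩
      simp only at h'
      simp only [i₁, Prod.mk.injEq]
      omega
    · intro p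
      simp [i₁]
  have t₂ : HasSum (fun p : ℤ × ℤ => if p.1 ≤ -1 ∧ p.2 ≤ -1 then F p.1 p.2 else 0)
      (∑' p : ℕ × ℕ, F (-1 - p.1) (-1 - p.2)) := by
    refine (hi₂.hasSum_iff ?_).1 (s₂.hasSum.congr_fun ?_)
    · rintro ⟨r, s⟩ hp
      refine if_neg fun h' => hp ⟨((-1 - r).toNat, (-1 - s).toNat), ?_⟩
      simp only at h'
      simp only [i₂, Prod.mk.injEq]
      omega
    · intro p
      simp [i₂]
  rw [← (t₁.sub t₂).tsum_eq]
  refine tsum_congr ?_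
  rintro ⟨r, s⟩
  simp only [sg₂, sg]
  by_cases hr : 0 ≤ r <;> by_cases hs : 0 ≤ s
  · simp [hr, hs, show ¬ r ≤ -1 by omega]
  · simp [hr, hs, show ¬ r ≤ -1 by omega]
  · simp [hr, hs, show ¬ s ≤ -1 by omega]
  · simp [hr, hs, show r ≤ -1 by omega, show s ≤ -1 by omega]

theorem tsum_quadTerm_right {t m : ℤ} {x q : ℂ} (hq0 : q ≠ 0) (hq : ‖q‖ < 1) (hx0 : x ≠ 0)
    (hx : ∀ n : ℤ, x ≠ q ^ n) (p : ℤ × ℤ) :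
    ∑' p', quadTerm t m x q p p' = sg₂ p.1 p.2 * gTerm t m x q p.1 p.2 * Theta x q := by
  simp only [quadTerm]
  rw [tsum_mul_left, ← heckeF, heckeF_one_one_one hq0 hq hx0 hx, gTerm]
  ring

/-- Summing the fourfold series over `(a, i)` first gives `Θ(x;q) g_{t,m}(x;q)`. -/
theorem summable_gTerm_and_gSeries_eq {t m : ℤ} (ht : 1 ≤ t) (hm₁ : -t ≤ m) (hm₂ : m ≤ 3 * t - 2)
    (htm : t ≡ m [ZMOD 2]) {x q : ℂ} (hq0 : q ≠ 0) (hq : ‖q‖ < 1) (hx0 : x ≠ 0)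
    (hx : ∀ n : ℤ, x ≠ q ^ n) :
    Summable (gTermNonneg t m x q) ∧ Summable (gTermNeg t m x q) ∧
      gSeries t m x q * Theta x q = ∑' p, ∑' p', quadTerm t m x q p p' := by
  have h := (summable_quadTerm ht hm₁ hm₂ htm hq0 hq hx0).prod
  simp only [Function.uncurry_apply_pair, tsum_quadTerm_right hq0 hq hx0 hx] at h ⊢
  rw [summable_mul_right_iff (Theta_ne_zero hq0 hq hx)] at h
  obtain ⟨h₁, h₂, h₃⟩ := tsum_sg₂_mul h
  refine ⟨h₁, h₂, ?_⟩
  rw [tsum_mul_right, h₃]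
  rfl

/-! ### Summation to products of Hecke-type double sums -/

theorem gExponent_eq (t h r s : ℤ) :
    gExponent t (t - 2 * h) r s = 1 * binomTwo r + 2 * t * r * s + 1 * binomTwo s +
      (1 + (t - h)) * r + (1 + h) * s := by
  have h1 := two_mul_gExponent (t := t) (m := t - 2 * h)
    ((Int.modEq_iff_dvd).2 ⟨-h, by ring⟩) r s
  have h2 := two_mul_binomTwo r
  have h3 := two_mul_binomTwo s
  linarith

/-- Summing the fourfold series over `(r, s)` first gives a double sum `f_{1,2t,1}`. -/
theorem tsum_quadTerm_left {t h : ℤ} {x q : ℂ} (hq0 : q ≠ 0) (a i : ℤ) :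
    ∑' p, quadTerm t (t - 2 * h) x q p (a, i) =
      sg₂ a i * (-1) ^ (a + i) * x⁻¹ ^ a * q ^ binomTwo (a + i + 1) *
        heckeF 1 (2 * t) 1 (q ^ (1 + (t - h) + i)) (q ^ (1 + h)) q := by
  rw [heckeF, ← tsum_mul_left]
  refine tsum_congr ?_
  rintro ⟨r, s⟩
  rw [quadTerm_eq hq0, gExponent_eq]
  simp only [heckeTerm]
  rw [← zpow_mul, ← zpow_mul, show 1 * binomTwo r + 2 * t * r * s + 1 * binomTwo s +
      (1 + (t - h)) * r + (1 + h) * s + r * i + binomTwo (a + i + 1) =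
    binomTwo (a + i + 1) + (1 + (t - h) + i) * r + (1 + h) * s +
      (1 * binomTwo r + 2 * t * r * s + 1 * binomTwo s) by ring, zpow_add₀ hq0, zpow_add₀ hq0,
    zpow_add₀ hq0]
  ring

/-- Splitting the second index of a double series into residue classes. -/
theorem tsum_eq_sum_residues {n : ℤ} (hn : 1 ≤ n) {f : ℤ × ℤ → ℂ} (hf : Summable f) :
    ∑' p, f p = ∑ k ∈ Finset.Icc (0 : ℤ) (n - 1), ∑' p : ℤ × ℤ, f (p.1, k + n * p.2) := by
  lift n to ℕ using by omega
  have : NeZero n := ⟨by omega⟩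
  -- The pair `(k, (a, s))` stands for `(a, k + n * s)`.
  let e : Fin n × (ℤ × ℤ) ≃ ℤ × ℤ := (Equiv.prodComm _ _).trans
    ((Equiv.prodAssoc _ _ _).trans ((Equiv.refl ℤ).prodCongr (Int.divModEquiv n).symm))
  have he : ∀ k p, e (k, p) = (p.1, (k : ℤ) + n * p.2) := fun k p => by
    simp [e, Int.divModEquiv]
    ring
  have hs : Summable fun p => f (e p) := e.summable_iff.2 hf
  rw [← e.tsum_eq, hs.tsum_prod, tsum_fintype]
  simp only [he]
  rw [Fin.sum_univ_eq_sum_range (fun k => ∑' p : ℤ × ℤ, f (p.1, (k : ℤ) + n * p.2)) n]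
  refine Finset.sum_nbij' (fun k => (k : ℤ)) Int.toNat ?_ ?_ ?_ ?_ ?_
  · intro k hk
    simp only [Finset.mem_range, Finset.mem_Icc] at hk ⊢
    omega
  · intro k hk
    simp only [Finset.mem_range, Finset.mem_Icc] at hk ⊢
    omega
  · intro k _
    simp
  · intro k hk
    simp only [Finset.mem_Icc] at hk
    omega
  · intro k _
    rfl

theorem sg₂_add_mul {n k : ℤ} (hk : k ∈ Finset.Icc 0 (n - 1)) (a s : ℤ) :
    sg₂ a (k + n * s) = sg₂ a s := by
  rw [Finset.mem_Icc] at hk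
  have : 0 ≤ k + n * s ↔ 0 ≤ s := by
    constructor <;> intro h <;> nlinarith
  simp only [sg₂, sg, this]

/-- The part of the fourfold series with `i ≡ k` modulo `4t² - 1`. -/
theorem tsum_residue {t h k : ℤ} (ht : 1 ≤ t) {x q : ℂ} (hq0 : q ≠ 0) (hq : ‖q‖ < 1)
    (hk : k ∈ Finset.Icc (0 : ℤ) (4 * t ^ 2 - 1 - 1)) :
    ∑' p : ℤ × ℤ, sg₂ p.1 (k + (4 * t ^ 2 - 1) * p.2) *
        (-1) ^ (p.1 + (k + (4 * t ^ 2 - 1) * p.2)) * x⁻¹ ^ p.1 *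
        q ^ binomTwo (p.1 + (k + (4 * t ^ 2 - 1) * p.2) + 1) *
        heckeF 1 (2 * t) 1 (q ^ (1 + (t - h) + (k + (4 * t ^ 2 - 1) * p.2))) (q ^ (1 + h)) q =
      q ^ (1 - 3 * t ^ 2 - h + t * (t - 2 * h)) * ((-1) ^ (k + 1) * q ^ (binomTwo (k + 1) + k) *
        heckeF 1 (2 * t) 1 (q ^ (2 - 4 * t ^ 2 + (t - h) + k)) (q ^ (1 + h)) q *
        heckeF 1 (4 * t ^ 2 - 1) (4 * t ^ 2 * (4 * t ^ 2 - 1)) (x⁻¹ * q ^ (k + 1))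
          (-q ^ (4 * t ^ 2 * k - t ^ 2 + t * (t - 2 * h) - h + 8 * t ^ 4)) q) := by
  rw [← mul_assoc, heckeF.eq_def 1 (4 * t ^ 2 - 1), ← tsum_mul_left]
  refine tsum_congr ?_
  rintro ⟨a, s⟩
  have hu : 1 + (t - h) + (k + (4 * t ^ 2 - 1) * s) =
      2 - 4 * t ^ 2 + (t - h) + k + (4 * t ^ 2 - 1) * (s + 1) := by ring
  have hsign : (-1 : ℂ) ^ (a + (k + (4 * t ^ 2 - 1) * s)) * (-1) ^ (s + 1) =
      (-1) ^ (k + 1) * (-1) ^ (a + s) * (-1) ^ s := by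
    rw [← zpow_add₀ (by norm_num), ← zpow_add₀ (by norm_num), ← zpow_add₀ (by norm_num),
      show a + (k + (4 * t ^ 2 - 1) * s) + (s + 1) = k + 1 + (a + s) + s + 2 * ((2 * t ^ 2 - 1) * s)
        by ring, zpow_add₀ (by norm_num), zpow_mul]
    simp
  have hexp : binomTwo (a + (k + (4 * t ^ 2 - 1) * s) + 1) +
      ((s + 1) * (2 - 4 * t ^ 2 + (t - h) + k + (4 * t ^ 2 - 1) - 2 * t * (1 + h) -
        t * (2 * t - 1)) + (4 * t ^ 2 - 1) * binomTwo (s + 1)) =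
      1 - 3 * t ^ 2 - h + t * (t - 2 * h) + (binomTwo (k + 1) + k) + (k + 1) * a +
      (4 * t ^ 2 * k - t ^ 2 + t * (t - 2 * h) - h + 8 * t ^ 4) * s +
      (1 * binomTwo a + (4 * t ^ 2 - 1) * a * s +
        4 * t ^ 2 * (4 * t ^ 2 - 1) * binomTwo s) := by
    have h1 := two_mul_binomTwo (a + (k + (4 * t ^ 2 - 1) * s) + 1)
    have h2 := two_mul_binomTwo (s + 1)
    have h3 := two_mul_binomTwo (k + 1)
    have h4 := two_mul_binomTwo a
    have h5 := two_mul_binomTwo s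
    refine mul_left_cancel₀ (two_ne_zero' ℤ) ?_
    linear_combination h1 + (4 * t ^ 2 - 1) * h2 - h3 - h4 - 4 * t ^ 2 * (4 * t ^ 2 - 1) * h5
  have hq_exp := congrArg (q ^ ·) hexp
  simp only [zpow_add₀ hq0 _ (1 * binomTwo a + _ + _), zpow_add₀ hq0 _ (_ * s),
    zpow_add₀ hq0 _ ((k + 1) * a), zpow_add₀ hq0 _ (binomTwo (k + 1) + k),
    zpow_add₀ hq0 (binomTwo (a + _ + 1))] at hq_exp
  rw [zpow_mul, zpow_mul] at hq_exp
  simp only [heckeTerm]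
  rw [sg₂_add_mul hk, hu, heckeF_zpow_quasiperiodic hq0 hq ht, mul_zpow x⁻¹,
    neg_eq_neg_one_mul (q ^ (_ : ℤ)), mul_zpow (-1 : ℂ)]
  linear_combination sg₂ a s * x⁻¹ ^ a *
    heckeF 1 (2 * t) 1 (q ^ (2 - 4 * t ^ 2 + (t - h) + k)) (q ^ (1 + h)) q *
    (q ^ binomTwo (a + (k + (4 * t ^ 2 - 1) * s) + 1) *
      q ^ ((s + 1) * (2 - 4 * t ^ 2 + (t - h) + k + (4 * t ^ 2 - 1) - 2 * t * (1 + h) -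
        t * (2 * t - 1)) + (4 * t ^ 2 - 1) * binomTwo (s + 1)) * hsign +
      (-1) ^ (k + 1) * (-1) ^ (a + s) * (-1) ^ s * hq_exp)

end HeckeAppell

end

/-- `x` is generic when it is nonzero and not an integral power of `q`. All the series occurring
in the identity converge absolutely, and the identity holds. -/
theorem theorem1p1 (q : ℂ) (hq0 : q ≠ 0) (hq1 : ‖q‖ < 1)
    (t m : ℤ) (ht : 1 ≤ t) (hm₁ : -t ≤ m) (hm₂ : m ≤ 3 * t - 2) (htm : t ≡ m [ZMOD 2])
    (x : ℂ) (hx0 : x ≠ 0) (hx : ∀ n : ℤ, x ≠ q ^ n) :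
    Summable (HeckeAppell.gTermNonneg t m x q) ∧
    Summable (HeckeAppell.gTermNeg t m x q) ∧
    (∀ k ∈ Finset.Icc (0 : ℤ) (4 * t ^ 2 - 2),
      Summable (HeckeAppell.heckeTerm 1 (2 * t) 1
        (q ^ (2 - 4 * t ^ 2 + (t + m) / 2 + k)) (q ^ (1 + (t - m) / 2)) q) ∧
      Summable (HeckeAppell.heckeTerm 1 (4 * t ^ 2 - 1) (4 * t ^ 2 * (4 * t ^ 2 - 1))
        (x⁻¹ * q ^ (k + 1))
        (-q ^ (4 * t ^ 2 * k - t ^ 2 + t * m - (t - m) / 2 + 8 * t ^ 4)) q)) ∧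
    HeckeAppell.calU t m x q =
      (1 - x) / HeckeAppell.Theta x q *
        (q ^ (1 - 3 * t ^ 2 - (t - m) / 2 + t * m) / HeckeAppell.qPochInf q q ^ 2) *
        ∑ k ∈ Finset.Icc (0 : ℤ) (4 * t ^ 2 - 2),
          (-1) ^ (k + 1) * q ^ (HeckeAppell.binomTwo (k + 1) + k) *
          HeckeAppell.heckeF 1 (2 * t) 1
            (q ^ (2 - 4 * t ^ 2 + (t + m) / 2 + k)) (q ^ (1 + (t - m) / 2)) q *
          HeckeAppell.heckeF 1 (4 * t ^ 2 - 1) (4 * t ^ 2 * (4 * t ^ 2 - 1))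
            (x⁻¹ * q ^ (k + 1))
            (-q ^ (4 * t ^ 2 * k - t ^ 2 + t * m - (t - m) / 2 + 8 * t ^ 4)) q := by
  obtain ⟨h₁, h₂, h₃⟩ := HeckeAppell.summable_gTerm_and_gSeries_eq ht hm₁ hm₂ htm hq0 hq1 hx0 hx
  have hN : 1 ≤ 4 * t ^ 2 - 1 := by nlinarith
  refine ⟨h₁, h₂, fun k _ => ⟨?_, ?_⟩, ?_⟩
  · exact HeckeAppell.summable_heckeTerm le_rfl (by omega) le_rfl hq0 hq1
      (zpow_ne_zero _ hq0) (zpow_ne_zero _ hq0)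
  · exact HeckeAppell.summable_heckeTerm le_rfl (by omega) (by nlinarith) hq0 hq1
      (mul_ne_zero (inv_ne_zero hx0) (zpow_ne_zero _ hq0)) (neg_ne_zero.2 (zpow_ne_zero _ hq0))
  have hsum := HeckeAppell.summable_quadTerm ht hm₁ hm₂ htm hq0 hq1 hx0
  -- With `m = t - 2h` the halves in the exponents become integers.
  obtain ⟨h, rfl⟩ : ∃ h, m = t - 2 * h := by
    obtain ⟨u, hu⟩ := htm.dvd
    exact ⟨-u, by omega⟩
  rw [show (t + (t - 2 * h)) / 2 = t - h by omega, show (t - (t - 2 * h)) / 2 = h by omega]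
  -- Exchange the two double summations and split `i` into residue classes modulo `4t² - 1`.
  have hsum' := hsum.prod_symm.prod
  simp only [Prod.swap_prod_mk, Function.uncurry_apply_pair] at hsum'
  have key : HeckeAppell.gSeries t (t - 2 * h) x q * HeckeAppell.Theta x q = _ :=
    h₃.trans (hsum.tsum_comm.symm.trans (HeckeAppell.tsum_eq_sum_residues hN hsum'))
  simp only [HeckeAppell.tsum_quadTerm_left hq0] at key
  rw [Finset.sum_congr rfl fun k hk => HeckeAppell.tsum_residue ht hq0 hq1 hk,
    ← Finset.mul_sum,
    show 4 * t ^ 2 - 1 - 1 = 4 * t ^ 2 - 2 by ring] at key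
  rw [HeckeAppell.calU, eq_div_of_mul_eq (HeckeAppell.Theta_ne_zero hq0 hq1 hx) key]
  ring
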